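/- Programs have finitely many integer-valued program variables and finitely many independent sampling variables, each with a discrete distribution on $\mathbb{Z}$. They are built from $\mathbf{skip}$, assignments $v:=e$ (with $e$ an arithmetic expression over program and sampling variables), sequential composition, conditional, nondeterministic ($\star$) and probabilistic branching, and while loops. Arithmetic expressions use integer constants, $+$, $-$, $\times$ and an arbitrary fixed set of further operations. The semantics of a program is the Markov decision process on configurations (label of the control flow graph, valuation $\nu$ of the program variables). A scheduler maps each finite history to a probability distribution on the available actions, and a scheduler and an initial valuation determine a probability measure on runs. A program is almost-surely terminating from $\nu$ if, under every scheduler, the terminal label is reached with probability $1$ from $\nu$; it is almost-surely terminating if this holds for every $\nu$. The FHV-rule for a loop $P=\mathbf{while}\ G\ \mathbf{do}\ P_1;\dots;P_n\ \mathbf{od}$ infers that $P$ is almost-surely terminating from the following premises: every $P_k$ is almost-surely terminating, and there are a propositionally linear function $R$ (a finite sum $\sum_i[\varphi_i]\cdot a_i$ with linear predicates $\varphi_i$ and affine $a_i$) of the program variables and an $\varepsilon>0$ (together a compositional RSM) such that - $R(\nu)\ge 0$ for every valuation $\nu$ that satisfies $G$; - for every $k$, every initial valuation $\nu$ and every scheduler,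 $R$ is integrable after the execution of $P_k$ from $\nu$, with expected value at most $R(\nu)$; - for some $k$, this expected value is at most $R(\nu)-\varepsilon$, for every $\nu$ and every scheduler. $R$ is called integrable for a program if, from every initial valuation and under every scheduler, the value $R(\nu_n)$ after $n$ steps is integrable for all $n$. It is called difference-bounded for a program if there is a constant $c>0$ with $|R(\nu_{n+1})-R(\nu_n)|\le c$ almost surely for all $n$, all initial valuations and all schedulers. **Theorem.** The FHV-rule is not sound for almost-sure termination: there is a loop for which its premises hold but which is not almost-surely terminating. It remains unsound if $R$ is in addition required to be integrable and difference-bounded for the loop $P$ and for each $P_k$. Specifically, let $r$ be a sampling variable with $\mathbb{P}(r=1)=\mathbb{P}(r=-1)=\tfrac12$ and consider the program $$\begin{aligned}&\mathbf{while}\ x\ge 1\ \mathbf{do}\\&\quad z:=y;\\&\quad \mathbf{while}\ z\ge 0\ \mathbf{do}\ (\mathbf{if}\ x<2\ \mathbf{then}\ x:=x+r\ \mathbf{else}\ \mathbf{skip}\ \mathbf{fi});\ z:=z-1\ \mathbf{od};\\&\quad y:=4\times y;\\&\quad x:=x-1\\&\mathbf{od}\end{aligned}$$ whose body consists of the four parts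 $z:=y$, the inner loop, $y:=4\times y$ and $x:=x-1$. All premises of the rule, including integrability and difference-boundedness, hold for this program with $R=x$, but it is not almost-surely terminating from any initial valuation with $x=1$ and $y$ sufficiently large. -/

import Mathlib

namespace FHV

open MeasureTheory ProbabilityTheory

/-! ## Expressions and programs

Program variables are indexed by `Fin p`, sampling variables by `Fin q`. The parameter `Ops` is the
set of arithmetic operations that the language has besides `+`, `-`, `*`. -/

/-- Valuations of the program variables. -/
abbrev Val (p : ℕ) : Type := Fin p → ℤ

/-- Arithmetic expressions over the variables `V`. -/
inductive AExpr (Ops : Set (ℤ → ℤ → ℤ)) (V : Type) : Type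
  | const (n : ℤ)
  | var (v : V)
  | add (a b : AExpr Ops V)
  | sub (a b : AExpr Ops V)
  | mul (a b : AExpr Ops V)
  | op (f : Ops) (a b : AExpr Ops V)

/-- The value of an arithmetic expression. -/
def AExpr.eval {Ops : Set (ℤ → ℤ → ℤ)} {V : Type} (ν : V → ℤ) : AExpr Ops V → ℤ
  | .const n => n
  | .var v => ν v
  | .add a b => a.eval ν + b.eval ν
  | .sub a b => a.eval ν - b.eval ν
  | .mul a b => a.eval ν * b.eval ν
  | .op f a b => f.1 (a.eval ν) (b.eval ν)

/-- Propositional arithmetic predicates over `p` program variables. -/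
inductive BExpr (Ops : Set (ℤ → ℤ → ℤ)) (p : ℕ) : Type
  | lt (a b : AExpr Ops (Fin p))
  | le (a b : AExpr Ops (Fin p))
  | gt (a b : AExpr Ops (Fin p))
  | ge (a b : AExpr Ops (Fin p))
  | not (φ : BExpr Ops p)
  | or (φ ψ : BExpr Ops p)
  | and (φ ψ : BExpr Ops p)

/-- The truth value of a predicate. -/
def BExpr.eval {Ops : Set (ℤ → ℤ → ℤ)} {p : ℕ} (ν : Val p) : BExpr Ops p → Bool
  | .lt a b => decide (a.eval ν < b.eval ν)
  | .le a b => decide (a.eval ν ≤ b.eval ν)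
  | .gt a b => decide (a.eval ν > b.eval ν)
  | .ge a b => decide (a.eval ν ≥ b.eval ν)
  | .not φ => !(φ.eval ν)
  | .or φ ψ => φ.eval ν || ψ.eval ν
  | .and φ ψ => φ.eval ν && ψ.eval ν

/-- Probabilistic programs with `p` program variables and `q` sampling variables. The right-hand
side of an assignment may use both kinds of variables. -/
inductive Prog (Ops : Set (ℤ → ℤ → ℤ)) (p q : ℕ) : Type
  | skip
  | assign (v : Fin p) (e : AExpr Ops (Fin p ⊕ Fin q))
  | seq (P Q : Prog Ops p q)
  | ite (φ : BExpr Ops p) (P Q : Prog Ops p q)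
  | nondet (P Q : Prog Ops p q)
  | prob (r : unitInterval) (P Q : Prog Ops p q)
  | while (φ : BExpr Ops p) (P : Prog Ops p q)

/-- `P₁; …; Pₙ`. -/
def Prog.seqAll {Ops : Set (ℤ → ℤ → ℤ)} {p q : ℕ} : List (Prog Ops p q) → Prog Ops p q
  | [] => .skip
  | [P] => P
  | P :: Q :: Ps => .seq P (Prog.seqAll (Q :: Ps))

/-! ## Control flow graphs -/

/-- The outgoing transitions of a label, with target labels in `L`. -/
inductive Instr (Ops : Set (ℤ → ℤ → ℤ)) (p q : ℕ) (L : Type) : Type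
  | assign (u : Val p → (Fin q → ℤ) → Val p) (t : L)
  | branch (φ : BExpr Ops p) (t e : L)
  | prob (r : unitInterval) (t e : L)
  | nondet (t e : L)

/-- Renaming of the target labels. -/
def Instr.map {Ops : Set (ℤ → ℤ → ℤ)} {p q : ℕ} {L L' : Type} (f : L → L') :
    Instr Ops p q L → Instr Ops p q L'
  | .assign u t => .assign u (f t)
  | .branch φ t e => .branch φ (f t) (f e)
  | .prob r t e => .prob r (f t) (f e)
  | .nondet t e => .nondet (f t) (f e)

/-- A control flow graph. The labels are `Option Label`, where `none` is the terminal label. -/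
structure CFG (Ops : Set (ℤ → ℤ → ℤ)) (p q : ℕ) : Type 1 where
  Label : Type
  [finite : Finite Label]
  init : Label
  instr : Label → Instr Ops p q (Option Label)

attribute [instance] CFG.finite

/-- The graph with a single label, which applies the update `u`. -/
def CFG.single {Ops : Set (ℤ → ℤ → ℤ)} {p q : ℕ} (u : Val p → (Fin q → ℤ) → Val p) :
    CFG Ops p q where
  Label := Unit
  init := ()
  instr := fun _ => .assign u none

/-- Sequential composition: termination of the first graph leads to the start of the second. -/
def CFG.seq {Ops : Set (ℤ → ℤ → ℤ)} {p q : ℕ} (C D : CFG Ops p q) : CFG Ops p q where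
  Label := C.Label ⊕ D.Label
  init := .inl C.init
  instr := fun l => match l with
    | .inl l => (C.instr l).map fun t => match t with
      | none => some (.inr D.init)
      | some t => some (.inl t)
    | .inr l => (D.instr l).map (Option.map .inr)

/-- A new initial label with the branching instruction `i` (`true` for the then-branch `C`, `false`
for the else-branch `D`). -/
def CFG.branching {Ops : Set (ℤ → ℤ → ℤ)} {p q : ℕ} (i : Instr Ops p q Bool) (C D : CFG Ops p q) :
    CFG Ops p q where
  Label := Option (C.Label ⊕ D.Label)
  init := none
  instr := fun l => match l with
    | none => i.map fun b => if b then some (some (.inl C.init)) else some (some (.inr D.init))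
    | some (.inl l) => (C.instr l).map (Option.map fun t => some (.inl t))
    | some (.inr l) => (D.instr l).map (Option.map fun t => some (.inr t))

/-- A new initial label, the loop head, to which leaving the body `C` leads back. -/
def CFG.loop {Ops : Set (ℤ → ℤ → ℤ)} {p q : ℕ} (φ : BExpr Ops p) (C : CFG Ops p q) :
    CFG Ops p q where
  Label := Option C.Label
  init := none
  instr := fun l => match l with
    | none => .branch φ (some (some C.init)) none
    -- the head is the label `some none`, so `none` and `some t` go to `some none`, `some (some t)`
    | some l => (C.instr l).map some

/-- The control flow graph of a program, with one label for each assignment, skip, branching and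
while statement. -/
def Prog.cfg {Ops : Set (ℤ → ℤ → ℤ)} {p q : ℕ} : Prog Ops p q → CFG Ops p q
  | .skip => .single fun ν _ => ν
  | .assign v e => .single fun ν μ => Function.update ν v (e.eval (Sum.elim ν μ))
  | .seq P Q => .seq P.cfg Q.cfg
  | .ite φ P Q => .branching (.branch φ true false) P.cfg Q.cfg
  | .nondet P Q => .branching (.nondet true false) P.cfg Q.cfg
  | .prob r P Q => .branching (.prob r true false) P.cfg Q.cfg
  | .while φ P => .loop φ P.cfg

/-! ## The Markov decision process and the run measure -/

/-- Configurations: a label and a valuation. -/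
structure Config {Ops : Set (ℤ → ℤ → ℤ)} {p q : ℕ} (C : CFG Ops p q) : Type where
  loc : Option C.Label
  val : Val p

section Semantics

variable {Ops : Set (ℤ → ℤ → ℤ)} {p q : ℕ}

instance (C : CFG Ops p q) : MeasurableSpace (Config C) := ⊤

instance (C : CFG Ops p q) : DiscreteMeasurableSpace (Config C) := ⟨fun _ => trivial⟩

instance (C : CFG Ops p q) : Countable (Config C) := by
  refine Function.Injective.countable (f := fun c : Config C => (c.loc, c.val)) ?_
  rintro ⟨a, b⟩ ⟨c, d⟩ h
  simpa using h

/-- The actions of the Markov decision process. -/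
inductive Act : Type
  | tau
  | thenBranch
  | elseBranch

/-- The actions that are available at a configuration. -/
def available {C : CFG Ops p q} (c : Config C) : Set Act :=
  match c.loc with
  | none => {Act.tau}
  | some l => match C.instr l with
    | .nondet _ _ => {Act.thenBranch, Act.elseBranch}
    | _ => {Act.tau}

/-- The joint distribution of the sampling variables. -/
noncomputable def joint (Υ : Fin q → PMF ℤ) : PMF (Fin q → ℤ) :=
  (Measure.pi fun r => (Υ r).toMeasure).toPMF

theorem joint_apply (Υ : Fin q → PMF ℤ) (μ : Fin q → ℤ) : joint Υ μ = ∏ r, Υ r (μ r) := by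
  simp [joint, Measure.toPMF_apply, Measure.pi_singleton, PMF.toMeasure_apply_singleton]

/-- The distribution of a coin that shows `true` with probability `r`. -/
noncomputable def flip (r : unitInterval) : PMF Bool :=
  PMF.ofFintype (fun b => if b then ENNReal.ofReal r else ENNReal.ofReal (1 - r)) (by
    have h0 := r.2.1
    have h1 : 0 ≤ 1 - (r : ℝ) := sub_nonneg.2 r.2.2
    simp [← ENNReal.ofReal_add h0 h1])

/-- The transition probabilities of the Markov decision process. (At a nondeterministic label the
action `tau` is not available; the value there is immaterial.) -/
noncomputable def trans (Υ : Fin q → PMF ℤ) {C : CFG Ops p q} (c : Config C) (a : Act) :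
    PMF (Config C) :=
  match c.loc with
  | none => PMF.pure c
  | some l => match C.instr l with
    | .assign u t => (joint Υ).map fun μ => ⟨t, u c.val μ⟩
    | .branch φ t e => PMF.pure ⟨if φ.eval c.val then t else e, c.val⟩
    | .prob r t e => (flip r).map fun b => ⟨if b then t else e, c.val⟩
    | .nondet t e => match a with
      | .thenBranch => PMF.pure ⟨t, c.val⟩
      | .elseBranch => PMF.pure ⟨e, c.val⟩
      | .tau => PMF.pure c

/-- Finite histories `c₀, …, cₙ`. -/
abbrev History (C : CFG Ops p q) (n : ℕ) : Type := Finset.Iic n → Config C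

/-- The last configuration of a history. -/
def History.last {C : CFG Ops p q} {n : ℕ} (h : History C n) : Config C :=
  h ⟨n, Finset.mem_Iic.2 le_rfl⟩

/-- Schedulers: each history is mapped to a distribution on the actions available at its last
configuration. -/
structure Scheduler (C : CFG Ops p q) : Type where
  choose : (n : ℕ) → History C n → PMF Act
  support_subset : ∀ (n : ℕ) (h : History C n), (choose n h).support ⊆ available h.last

/-- The distribution of the next configuration after a given history. -/
noncomputable def stepKernel (Υ : Fin q → PMF ℤ) {C : CFG Ops p q} (σ : Scheduler C) (n : ℕ) :
    Kernel (History C n) (Config C) :=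
  Kernel.ofFunOfCountable fun h =>
    ((σ.choose n h).bind fun a => trans Υ h.last a).toMeasure

instance (Υ : Fin q → PMF ℤ) {C : CFG Ops p q} (σ : Scheduler C) (n : ℕ) :
    IsMarkovKernel (stepKernel Υ σ n) :=
  ⟨fun h => by
    change IsProbabilityMeasure ((σ.choose n h).bind fun a => trans Υ h.last a).toMeasure
    infer_instance⟩

/-- Runs: infinite sequences of configurations. -/
abbrev Run (C : CFG Ops p q) : Type := ℕ → Config C

/-- The probability measure on runs that start in `c` under the scheduler `σ`, given by the
Ionescu-Tulcea theorem. -/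
noncomputable def runMeasure (Υ : Fin q → PMF ℤ) {C : CFG Ops p q} (σ : Scheduler C)
    (c : Config C) : Measure (Run C) :=
  Kernel.traj (X := fun _ => Config C) (stepKernel Υ σ) 0 fun _ => c

/-- The initial configuration with valuation `ν`. -/
def CFG.start (C : CFG Ops p q) (ν : Val p) : Config C := ⟨some C.init, ν⟩

/-- The termination time of a run. -/
noncomputable def termTime {C : CFG Ops p q} (ω : Run C) : ℕ∞ :=
  sInf {t : ℕ∞ | ∃ n : ℕ, t = n ∧ (ω n).loc = none}

/-- The valuation at the termination time (used for terminating runs only). -/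
noncomputable def finalVal {C : CFG Ops p q} (ω : Run C) : Val p :=
  (ω (termTime ω).toNat).val

/-- Almost-sure termination from the initial valuation `ν`, under every scheduler. -/
def Prog.TerminatesFrom (Υ : Fin q → PMF ℤ) (P : Prog Ops p q) (ν : Val p) : Prop :=
  ∀ σ : Scheduler P.cfg, runMeasure Υ σ (P.cfg.start ν) {ω | termTime ω < ⊤} = 1

/-- Almost-sure termination from every initial valuation. -/
def Prog.Terminates (Υ : Fin q → PMF ℤ) (P : Prog Ops p q) : Prop :=
  ∀ ν : Val p, P.TerminatesFrom Υ ν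

/-! ## The rule -/

/-- Affine expressions over the program variables. -/
structure Affine (p : ℕ) : Type where
  coeff : Fin p → ℝ
  const : ℝ

/-- The value of an affine expression. -/
def Affine.eval (a : Affine p) (ν : Val p) : ℝ := ∑ i, a.coeff i * (ν i : ℝ) + a.const

/-- Linear predicates: propositional combinations of inequalities `a ≤ 0` with `a` affine. -/
inductive LinPred (p : ℕ) : Type
  | nonpos (a : Affine p)
  | not (φ : LinPred p)
  | or (φ ψ : LinPred p)
  | and (φ ψ : LinPred p)

/-- Satisfaction of a linear predicate. -/
def LinPred.Holds (ν : Val p) : LinPred p → Prop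
  | .nonpos a => a.eval ν ≤ 0
  | .not φ => ¬ φ.Holds ν
  | .or φ ψ => φ.Holds ν ∨ ψ.Holds ν
  | .and φ ψ => φ.Holds ν ∧ ψ.Holds ν

open Classical in
/-- Propositionally linear functions: `[φ₁] · a₁ + … + [φₘ] · aₘ` with linear predicates `φᵢ` and
affine expressions `aᵢ`. -/
def IsPropLinear (R : Val p → ℝ) : Prop :=
  ∃ L : List (LinPred p × Affine p),
    ∀ ν, R ν = (L.map fun s => if s.1.Holds ν then s.2.eval ν else 0).sum

/-- The triple `{R = z} P {R ≤ z - δ}` in the sense of expectations: from every initial valuation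
and under every scheduler, `R` is integrable after `P`, with expected value at most its initial
value minus `δ`. -/
def ExpectedDecrease (Υ : Fin q → PMF ℤ) (R : Val p → ℝ) (P : Prog Ops p q) (δ : ℝ) : Prop :=
  ∀ (ν : Val p) (z : ℝ), R ν = z → ∀ σ : Scheduler P.cfg,
    Integrable (fun ω => R (finalVal ω)) (runMeasure Υ σ (P.cfg.start ν)) ∧
      ∫ ω, R (finalVal ω) ∂(runMeasure Υ σ (P.cfg.start ν)) ≤ z - δ

/-- `R` is integrable after every number of steps of `P`. -/
def IntegrableAlong (Υ : Fin q → PMF ℤ) (R : Val p → ℝ) (P : Prog Ops p q) : Prop :=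
  ∀ (ν : Val p) (σ : Scheduler P.cfg) (n : ℕ),
    Integrable (fun ω : Run P.cfg => R (ω n).val) (runMeasure Υ σ (P.cfg.start ν))

/-- `R` changes by at most a constant in every single step of `P`. -/
def DifferenceBounded (Υ : Fin q → PMF ℤ) (R : Val p → ℝ) (P : Prog Ops p q) : Prop :=
  ∃ c : ℝ, 0 < c ∧ ∀ (ν : Val p) (σ : Scheduler P.cfg) (n : ℕ),
    ∀ᵐ ω ∂(runMeasure Υ σ (P.cfg.start ν)), |R (ω (n + 1)).val - R (ω n).val| ≤ c

/-- `R` is a compositional ranking supermartingale, with decrease `ε`, for the loop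
`while G do P₁; …; Pₙ od`. -/
structure IsCompositionalRSM (Υ : Fin q → PMF ℤ) (G : BExpr Ops p) (Ps : List (Prog Ops p q))
    (R : Val p → ℝ) (ε : ℝ) : Prop where
  propLinear : IsPropLinear R
  eps_pos : 0 < ε
  nonneg_on_guard : ∀ ν : Val p, G.eval ν = true → 0 ≤ R ν
  unaffecting : ∀ P ∈ Ps, ExpectedDecrease Υ R P 0
  ranking : ∃ P ∈ Ps, ExpectedDecrease Υ R P ε

/-- The premises of the rule for `while G do P₁; …; Pₙ od` and the expression `R`. -/
structure RulePremises (Υ : Fin q → PMF ℤ) (G : BExpr Ops p) (Ps : List (Prog Ops p q))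
    (R : Val p → ℝ) : Prop where
  body_terminates : ∀ P ∈ Ps, P.Terminates Υ
  rsm : ∃ ε : ℝ, IsCompositionalRSM Υ G Ps R ε

/-- The premises of the rule, with `R` required in addition to be integrable and difference-bounded,
both in the whole loop and in each `Pₖ`. -/
structure BoundedRulePremises (Υ : Fin q → PMF ℤ) (G : BExpr Ops p) (Ps : List (Prog Ops p q))
    (R : Val p → ℝ) : Prop extends RulePremises Υ G Ps R where
  integrable_loop : IntegrableAlong Υ R (.while G (Prog.seqAll Ps))
  integrable_body : ∀ P ∈ Ps, IntegrableAlong Υ R P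
  bounded_loop : DifferenceBounded Υ R (.while G (Prog.seqAll Ps))
  bounded_body : ∀ P ∈ Ps, DifferenceBounded Υ R P

end Semantics

/-- Soundness of the rule: whenever its premises hold, the loop is almost-surely terminating from
every initial valuation. -/
def RuleSound (Ops : Set (ℤ → ℤ → ℤ)) : Prop :=
  ∀ (p q : ℕ) (Υ : Fin q → PMF ℤ) (G : BExpr Ops p) (Ps : List (Prog Ops p q)) (R : Val p → ℝ),
    RulePremises Υ G Ps R → (Prog.while G (Prog.seqAll Ps)).Terminates Υ

/-- Soundness of the rule when it may be applied only with an integrable and difference-bounded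
expression `R`. -/
def BoundedRuleSound (Ops : Set (ℤ → ℤ → ℤ)) : Prop :=
  ∀ (p q : ℕ) (Υ : Fin q → PMF ℤ) (G : BExpr Ops p) (Ps : List (Prog Ops p q)) (R : Val p → ℝ),
    BoundedRulePremises Υ G Ps R → (Prog.while G (Prog.seqAll Ps)).Terminates Υ

/-! ## The nested-loop program -/

section Example

/-- The sampling variable takes the values `1` and `-1` with probability `1/2` each. -/
noncomputable def exSampling : Fin 1 → PMF ℤ := fun _ =>
  PMF.uniformOfFinset {1, -1} ⟨1, by simp⟩

variable (Ops : Set (ℤ → ℤ → ℤ))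

/-- The program variable `x`. -/
abbrev exX : Fin 3 := 0

/-- The program variable `y`. -/
abbrev exY : Fin 3 := 1

/-- The program variable `z`. -/
abbrev exZ : Fin 3 := 2

/-- The guard `x ≥ 1` of the outer loop. -/
def exGuard : BExpr Ops 3 := .ge (.var exX) (.const 1)

/-- `while z ≥ 0 do (if x < 2 then x := x + r else skip fi); z := z - 1 od`. -/
def exInner : Prog Ops 3 1 :=
  .while (.ge (.var exZ) (.const 0))
    (.seq
      (.ite (.lt (.var exX) (.const 2))
        (.assign exX (.add (.var (.inl exX)) (.var (.inr 0))))
        .skip)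
      (.assign exZ (.sub (.var (.inl exZ)) (.const 1))))

/-- The four parts of the outer body: `z := y`, the inner loop, `y := 4 * y`, `x := x - 1`. -/
def exBody : List (Prog Ops 3 1) :=
  [.assign exZ (.var (.inl exY)),
   exInner Ops,
   .assign exY (.mul (.const 4) (.var (.inl exY))),
   .assign exX (.sub (.var (.inl exX)) (.const 1))]

/-- The whole program: `while x ≥ 1 do z := y; …; y := 4 * y; x := x - 1 od`. -/
def exProg : Prog Ops 3 1 := .while (exGuard Ops) (Prog.seqAll (exBody Ops))

end Example

end FHV

/-!
The premises hold because `x` is a martingale of the inner loop, is not changed by `z := y` and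
`y := 4 * y`, and is lowered by `x := x - 1`. Each of the four parts takes a number of steps that is
bounded in terms of its initial valuation (`exInnerRank` for the inner loop), so the expectation
after the part is the expectation after a fixed number of steps
(`expectedDecrease_of_supermartingale`), and single steps change `x` by at most `1`. The part that
ranks is `x := x - 1`.

The loop diverges because the inner loop is a fair random walk that starts at `1`, is stopped at `2`
and runs for `y + 1` iterations. It misses `2` only with probability of order `1 / √y`. If it
reaches `2`, the outer loop goes on with `x = 1` again and `y` multiplied by `4`, and the bounds
`3 / √y`, `3 / √(4 y)`, … on the probabilities of missing `2` sum up to `6 / √y`,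
which is less than `1` for `y ≥ 37`.

Both estimates are packed into one nonnegative function `exPotential` of the configuration that
does not increase in expectation (`exPotential_step`) and equals `1` at termination, so that its
initial value `6 / √y` bounds the probability of termination
(`CFG.CoinDriven.measure_termination_le`). Inside the inner loop it is made from the martingale
`λ ^ k * ρ ^ d`, with `k` the number of iterations done, `d = 2 - x`, `ρ = 1 - 1 / √y` and
`λ = 2 ρ / (1 + ρ ^ 2)`: then `1 - λ ^ k * ρ ^ d` is `1 / √y` at the start, nonnegative when `2` is
reached, and at least `1 / 3` when the loop ends without reaching `2` (`walkDiscount_pow_le`).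
Three times this function therefore bounds the probability of missing `2`.

None of the programs involved has nondeterministic or probabilistic branching. Hence the scheduler
has no influence, and each step is a function of the configuration and of a fair coin, `coinStep`;
the run measure is accessible through `CFG.CoinDriven.ae_path`, `CFG.CoinDriven.lintegral_succ` and
`CFG.CoinDriven.integral_succ`.
-/

namespace FHV

open MeasureTheory ProbabilityTheory

/-! ### Programs driven by a fair coin -/

/-- A fair coin. -/
noncomputable def coin : PMF Bool := PMF.uniformOfFintype Bool

/-- The values of the single sampling variable, as a function of a coin toss. -/
def coinSample (b : Bool) : Fin 1 → ℤ := fun _ => if b then 1 else -1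

theorem exSampling_apply (i : Fin 1) (n : ℤ) :
    exSampling i n = if n = 1 ∨ n = -1 then 2⁻¹ else 0 :=
  (PMF.uniformOfFinset_apply (s := {1, -1}) ⟨1, by simp⟩ n).trans (by simp)

theorem joint_exSampling : joint exSampling = coin.map coinSample := by
  ext μ
  rw [joint_apply, PMF.map_apply, tsum_bool]
  have e : ∀ b, μ = coinSample b ↔ μ 0 = if b then 1 else -1 := fun b =>
    ⟨fun h => by simp [h, coinSample], fun h => by ext i; fin_cases i; simpa [coinSample] using h⟩
  simp only [e, coin, exSampling_apply, PMF.uniformOfFintype_apply]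
  by_cases h1 : μ 0 = 1
  · simp [h1]
  · by_cases h2 : μ 0 = -1 <;> simp [h1, h2]

section CoinDriven

variable {Ops : Set (ℤ → ℤ → ℤ)} {p : ℕ}

/-- The graph consists of assignments and conditional branchings only, so that its only source of
randomness is the sampling variable. -/
def CFG.CoinDriven (C : CFG Ops p 1) : Prop :=
  ∀ l, match C.instr l with
    | .assign _ _ => True
    | .branch _ _ _ => True
    | _ => False

/-- The successor of a configuration, given the coin toss that determines the sampling variable.
At probabilistic and nondeterministic labels, which do not occur in a coin-driven graph, the value
is arbitrary. -/
def coinStep {C : CFG Ops p 1} (c : Config C) (b : Bool) : Config C :=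
  match c.loc with
  | none => c
  | some l => match C.instr l with
    | .assign u t => ⟨t, u c.val (coinSample b)⟩
    | .branch φ t e => ⟨if φ.eval c.val then t else e, c.val⟩
    | _ => c

theorem coinStep_of_terminal {C : CFG Ops p 1} {c : Config C} (h : c.loc = none) (b : Bool) :
    coinStep c b = c := by
  simp [coinStep, h]

/-- The transition probabilities do not depend on the action, so the scheduler is irrelevant. -/
theorem CFG.CoinDriven.trans_eq {C : CFG Ops p 1} (hC : C.CoinDriven) (c : Config C) (a : Act) :
    trans exSampling c a = coin.map (coinStep c) := by
  rcases c with ⟨_ | l, ν⟩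
  · exact (PMF.map_const _ _).symm
  · have hl := hC l
    revert hl
    simp only [trans]
    unfold coinStep
    simp only
    cases C.instr l with
    | assign u t => intro _; simp only [joint_exSampling, PMF.map_comp]; rfl
    | branch φ t e => intro _; exact (PMF.map_const _ _).symm
    | prob r t e => exact fun h => h.elim
    | nondet t e => exact fun h => h.elim

theorem CFG.CoinDriven.stepKernel_apply {C : CFG Ops p 1} (hC : C.CoinDriven) (σ : Scheduler C)
    (n : ℕ) (h : History C n) :
    stepKernel exSampling σ n h = (coin.map (coinStep h.last)).toMeasure := by
  change ((σ.choose n h).bind fun a => trans exSampling h.last a).toMeasure = _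
  simp only [hC.trans_eq, PMF.bind_const]

instance {C : CFG Ops p 1} (σ : Scheduler C) (c : Config C) :
    IsProbabilityMeasure (runMeasure exSampling σ c) := by
  unfold runMeasure; infer_instance

/-- The joint law of a history and the next configuration. -/
theorem runMeasure_map_succ {C : CFG Ops p 1} (σ : Scheduler C) (c : Config C) (n : ℕ) :
    (runMeasure exSampling σ c).map
        (fun ω => ((Preorder.frestrictLe n ω : History C n), ω (n + 1))) =
      ((runMeasure exSampling σ c).map (fun ω => (Preorder.frestrictLe n ω : History C n))) ⊗ₘ
        stepKernel exSampling σ n := by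
  unfold runMeasure
  have h1 := Kernel.traj_map_frestrictLe_apply (X := fun _ => Config C)
    (κ := stepKernel exSampling σ) 0 n (fun _ => c)
  have h2 := Kernel.partialTraj_compProd_eq_map_traj (X := fun _ => Config C)
    (κ := stepKernel exSampling σ) (Nat.zero_le n) (x₀ := fun _ => c)
  erw [h1, ← h2]

theorem runMeasure_ae_zero {C : CFG Ops p 1} (σ : Scheduler C) (c : Config C) :
    ∀ᵐ ω ∂runMeasure exSampling σ c, ω 0 = c := by
  have h1 := Kernel.traj_map_frestrictLe_apply (X := fun _ => Config C)
    (κ := stepKernel exSampling σ) 0 0 (fun _ => c)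
  rw [Kernel.partialTraj_self, Kernel.id_apply] at h1
  have h2 : ∀ᵐ h ∂(Kernel.traj (X := fun _ => Config C) (stepKernel exSampling σ) 0
      fun _ => c).map (Preorder.frestrictLe 0), h ⟨0, by simp⟩ = c := by
    rw [h1, ae_dirac_iff]
    exact measurableSet_eq_fun (measurable_pi_apply _) measurable_const
  exact ae_of_ae_map (by fun_prop) h2

/-- Expectations of functions of the next configuration are computed by averaging over the coin. -/
theorem CFG.CoinDriven.lintegral_succ {C : CFG Ops p 1} (hC : C.CoinDriven) (σ : Scheduler C)
    (c : Config C) (g : Config C → ENNReal) (n : ℕ) :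
    ∫⁻ ω, g (ω (n + 1)) ∂runMeasure exSampling σ c =
      ∫⁻ ω, (g (coinStep (ω n) true) + g (coinStep (ω n) false)) / 2
        ∂runMeasure exSampling σ c := by
  have hg : Measurable g := measurable_from_top
  have h := congrArg (fun m => ∫⁻ x, g x.2 ∂m) (runMeasure_map_succ σ c n)
  rw [Measure.lintegral_compProd (by fun_prop), lintegral_map (by fun_prop) (by fun_prop),
    lintegral_map (Measurable.lintegral_kernel hg) (by fun_prop)] at h
  rw [h]
  congr 1 with ω
  have hlast : History.last (Preorder.frestrictLe n ω : History C n) = ω n := rfl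
  rw [hC.stepKernel_apply, hlast,
    ← PMF.toMeasure_map coin (f := coinStep (ω n)) Measurable.of_discrete,
    lintegral_map hg (by fun_prop),
    lintegral_fintype]
  simp [coin, ENNReal.div_eq_inv_mul, mul_comm, add_mul]

theorem CFG.CoinDriven.integral_succ {C : CFG Ops p 1} (hC : C.CoinDriven) (σ : Scheduler C)
    (c : Config C) (g : Config C → ℝ) (n : ℕ)
    (hi : Integrable (fun ω : Run C => g (ω (n + 1))) (runMeasure exSampling σ c)) :
    ∫ ω, g (ω (n + 1)) ∂runMeasure exSampling σ c =
      ∫ ω, (g (coinStep (ω n) true) + g (coinStep (ω n) false)) / 2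
        ∂runMeasure exSampling σ c := by
  have hg : Measurable g := measurable_from_top
  have h := congrArg (fun m => ∫ x, g x.2 ∂m) (runMeasure_map_succ σ c n)
  have hi' : Integrable (fun x : History C n × Config C => g x.2)
      ((runMeasure exSampling σ c).map
        (fun ω => ((Preorder.frestrictLe n ω : History C n), ω (n + 1)))) := by
    rw [integrable_map_measure (by fun_prop) (by fun_prop)]
    exact hi
  rw [Measure.integral_compProd (by rwa [← runMeasure_map_succ]),
    integral_map (by fun_prop) (by fun_prop), integral_map (by fun_prop)
    (Measurable.of_discrete.aestronglyMeasurable)] at h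
  rw [h]
  congr 1 with ω
  have hlast : History.last (Preorder.frestrictLe n ω : History C n) = ω n := rfl
  rw [hC.stepKernel_apply, hlast,
    ← PMF.toMeasure_map coin (f := coinStep (ω n)) Measurable.of_discrete,
    integral_map (by fun_prop) (by fun_prop), PMF.integral_eq_sum]
  simp [coin, div_eq_inv_mul, mul_add]

/-- Almost every run starts in the given configuration and follows `coinStep`. -/
theorem CFG.CoinDriven.ae_path {C : CFG Ops p 1} (hC : C.CoinDriven) (σ : Scheduler C)
    (c : Config C) :
    ∀ᵐ ω ∂runMeasure exSampling σ c, ω 0 = c ∧ ∀ n, ∃ b, ω (n + 1) = coinStep (ω n) b := by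
  refine (runMeasure_ae_zero σ c).and (ae_all_iff.2 fun n => ?_)
  have key : ∀ᵐ x ∂(runMeasure exSampling σ c).map
      (fun ω => ((Preorder.frestrictLe n ω : History C n), ω (n + 1))),
      ∃ b, x.2 = coinStep x.1.last b := by
    have hm : MeasurableSet {x : History C n × Config C | ∃ b, x.2 = coinStep x.1.last b} :=
      MeasurableSet.of_discrete
    rw [runMeasure_map_succ, Measure.ae_compProd_iff hm]
    refine Filter.Eventually.of_forall fun h => ?_
    rw [hC.stepKernel_apply, ← PMF.toMeasure_map coin (f := coinStep h.last) Measurable.of_discrete,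
      ae_map_iff (by fun_prop) MeasurableSet.of_discrete]
    exact Filter.Eventually.of_forall fun b => ⟨b, rfl⟩
  exact ae_of_ae_map (f := fun ω : Run C => ((Preorder.frestrictLe n ω : History C n), ω (n + 1)))
    (by fun_prop) key

end CoinDriven

/-! ### Termination and expectations -/

section CoinDriven

variable {Ops : Set (ℤ → ℤ → ℤ)} {p : ℕ}

theorem termTime_lt_top_iff {C : CFG Ops p 1} (ω : Run C) :
    termTime ω < ⊤ ↔ ∃ n, (ω n).loc = none := by
  rw [termTime, sInf_lt_iff]
  constructor
  · rintro ⟨_, ⟨n, _, hn⟩, _⟩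
    exact ⟨n, hn⟩
  · rintro ⟨n, hn⟩
    exact ⟨n, ⟨n, rfl, hn⟩, ENat.natCast_lt_top n⟩

theorem eq_of_terminal {C : CFG Ops p 1} {ω : Run C}
    (hω : ∀ n, ∃ b, ω (n + 1) = coinStep (ω n) b) {m n : ℕ} (hmn : m ≤ n)
    (hm : (ω m).loc = none) : ω n = ω m := by
  induction n, hmn using Nat.le_induction with
  | base => rfl
  | succ k _ ih =>
    obtain ⟨b, hb⟩ := hω k
    rw [hb, ih, coinStep_of_terminal hm]

theorem finalVal_eq {C : CFG Ops p 1} {ω : Run C}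
    (hω : ∀ n, ∃ b, ω (n + 1) = coinStep (ω n) b) {n : ℕ} (hn : (ω n).loc = none) :
    finalVal ω = (ω n).val := by
  obtain ⟨m, hm, hm'⟩ : termTime ω ∈ {t : ℕ∞ | ∃ n : ℕ, t = n ∧ (ω n).loc = none} :=
    csInf_mem ⟨n, n, rfl, hn⟩
  have hle : termTime ω ≤ n := sInf_le ⟨n, rfl, hn⟩
  rw [hm, Nat.cast_le] at hle
  rw [finalVal, hm, ENat.toNat_natCast, eq_of_terminal hω hle hm']

/-- A natural-valued rank that decreases in every step before termination bounds the number of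
steps on every run. -/
theorem terminal_of_rank {C : CFG Ops p 1} {ω : Run C}
    (hω : ∀ n, ∃ b, ω (n + 1) = coinStep (ω n) b) (rank : Config C → ℕ)
    (hrank : ∀ (c : Config C) (b : Bool), c.loc ≠ none → rank (coinStep c b) < rank c) :
    (ω (rank (ω 0))).loc = none := by
  have key : ∀ n, (ω n).loc = none ∨ rank (ω n) + n ≤ rank (ω 0) := by
    intro n
    induction n with
    | zero => simp
    | succ n ih =>
      obtain ⟨b, hb⟩ := hω n
      by_cases h : (ω n).loc = none
      · left; rw [hb, coinStep_of_terminal h, h]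
      · have := hrank (ω n) b h
        rw [← hb] at this
        have := ih.resolve_left h
        right; omega
  rcases key (rank (ω 0)) with h | h
  · exact h
  · by_contra h'
    have := hrank _ true h'
    omega

theorem CFG.CoinDriven.integrable_of_bounded_steps {C : CFG Ops p 1}
    (hC : C.CoinDriven) (g : Config C → ℝ) (K : ℝ)
    (hg : ∀ c b, |g (coinStep c b) - g c| ≤ K) (σ : Scheduler C) (c : Config C) (n : ℕ) :
    Integrable (fun ω : Run C => g (ω n)) (runMeasure exSampling σ c) := by
  have hgm : Measurable g := measurable_from_top
  refine Integrable.of_bound (hgm.comp (measurable_pi_apply n)).aestronglyMeasurable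
    (|g c| + n * K) ?_
  filter_upwards [hC.ae_path σ c] with ω ⟨h0, hω⟩
  rw [Real.norm_eq_abs]
  induction n with
  | zero => simp [h0]
  | succ n ih =>
    obtain ⟨b, hb⟩ := hω n
    have h1 := hg (ω n) b
    rw [← hb] at h1
    have h2 := abs_sub_abs_le_abs_sub (g (ω (n + 1))) (g (ω n))
    push_cast
    linarith

theorem CFG.CoinDriven.integral_le_of_supermartingale {C : CFG Ops p 1}
    (hC : C.CoinDriven) (g : Config C → ℝ) (K : ℝ)
    (hg : ∀ c b, |g (coinStep c b) - g c| ≤ K)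
    (hsup : ∀ c : Config C, (g (coinStep c true) + g (coinStep c false)) / 2 ≤ g c)
    (σ : Scheduler C) (c : Config C) (n : ℕ) :
    ∫ ω, g (ω n) ∂runMeasure exSampling σ c ≤ g c := by
  have hi := hC.integrable_of_bounded_steps g K hg σ c
  induction n with
  | zero =>
    have : (fun ω : Run C => g (ω 0)) =ᵐ[runMeasure exSampling σ c] fun _ => g c := by
      filter_upwards [runMeasure_ae_zero σ c] with ω h0
      rw [h0]
    rw [integral_congr_ae this]
    simp
  | succ n ih =>
    rw [hC.integral_succ σ c g n (hi (n + 1))]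
    refine (integral_mono ?_ (hi n) fun ω => hsup (ω n)).trans ih
    have hb : ∀ b, Integrable (fun ω : Run C => g (coinStep (ω n) b))
        (runMeasure exSampling σ c) := by
      intro b
      have hm : Measurable fun d : Config C => g (coinStep d b) := measurable_from_top
      refine Integrable.mono' ((hi n).abs.add (integrable_const K))
        (hm.comp (measurable_pi_apply n)).aestronglyMeasurable ?_
      refine Filter.Eventually.of_forall fun ω => ?_
      have h1 := hg (ω n) b
      have h2 := abs_sub_abs_le_abs_sub (g (coinStep (ω n) b)) (g (ω n))
      simp only [Pi.add_apply, Real.norm_eq_abs]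
      linarith
    exact ((hb true).add (hb false)).div_const 2

/-- A nonnegative function of the configuration that does not increase in expectation and is at
least `1` at the terminal configurations bounds the probability of termination. -/
theorem CFG.CoinDriven.measure_termination_le {C : CFG Ops p 1} (hC : C.CoinDriven)
    (h : Config C → ℝ) (hnonneg : ∀ c, 0 ≤ h c) (hterm : ∀ c : Config C, c.loc = none → 1 ≤ h c)
    (hsup : ∀ c : Config C, (h (coinStep c true) + h (coinStep c false)) / 2 ≤ h c)
    (σ : Scheduler C) (c : Config C) :
    runMeasure exSampling σ c {ω | termTime ω < ⊤} ≤ ENNReal.ofReal (h c) := by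
  have hmean : ∀ n, ∫⁻ ω, ENNReal.ofReal (h (ω n)) ∂runMeasure exSampling σ c ≤
      ENNReal.ofReal (h c) := by
    intro n
    induction n with
    | zero =>
      have : (fun ω : Run C => ENNReal.ofReal (h (ω 0))) =ᵐ[runMeasure exSampling σ c]
          fun _ => ENNReal.ofReal (h c) := by
        filter_upwards [runMeasure_ae_zero σ c] with ω h0
        rw [h0]
      rw [lintegral_congr_ae this]
      simp
    | succ n ih =>
      rw [hC.lintegral_succ σ c (fun c => ENNReal.ofReal (h c)) n]
      refine (lintegral_mono fun ω => ?_).trans ih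
      rw [← ENNReal.ofReal_add (hnonneg _) (hnonneg _), ← ENNReal.ofReal_ofNat 2,
        ← ENNReal.ofReal_div_of_pos two_pos]
      exact ENNReal.ofReal_le_ofReal (hsup (ω n))
  -- The terminal configurations are absorbing, so the probability of termination is the limit of
  -- the probabilities of being terminal after `n` steps.
  have hset : {ω : Run C | termTime ω < ⊤} = ⋃ n, {ω | ∃ m ≤ n, (ω m).loc = none} := by
    ext ω
    simp only [Set.mem_ofPred_eq, Set.mem_iUnion, termTime_lt_top_iff]
    exact ⟨fun ⟨n, hn⟩ => ⟨n, n, le_rfl, hn⟩, fun ⟨_, m, _, hm⟩ => ⟨m, hm⟩⟩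
  have hmono : Monotone fun n => {ω : Run C | ∃ m ≤ n, (ω m).loc = none} :=
    fun i j hij ω ⟨m, hm, hm'⟩ => ⟨m, hm.trans hij, hm'⟩
  rw [hset, hmono.measure_iUnion]
  refine iSup_le fun n => ?_
  have hgm : Measurable h := measurable_from_top
  refine le_trans ?_ (hmean n)
  refine le_trans ?_ (meas_ge_le_lintegral_div (μ := runMeasure exSampling σ c)
    (f := fun ω : Run C => ENNReal.ofReal (h (ω n)))
    (hgm.ennreal_ofReal.comp (measurable_pi_apply n)).aemeasurable one_ne_zero (by simp)
    |>.trans_eq (div_one _))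
  refine measure_mono_ae ?_
  filter_upwards [hC.ae_path σ c] with ω ⟨_, hω⟩ ⟨m, hm, hm'⟩
  change 1 ≤ ENNReal.ofReal (h (ω n))
  rw [eq_of_terminal hω hm hm', ENNReal.one_le_ofReal]
  exact hterm _ hm'

end CoinDriven

section Rule

variable {Ops : Set (ℤ → ℤ → ℤ)} {p : ℕ}

theorem Prog.terminates_of_rank {P : Prog Ops p 1} (hP : P.cfg.CoinDriven)
    (rank : Config P.cfg → ℕ)
    (hrank : ∀ (c : Config P.cfg) (b : Bool), c.loc ≠ none → rank (coinStep c b) < rank c) :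
    P.Terminates exSampling := by
  intro ν σ
  refine le_antisymm prob_le_one ?_
  rw [← measure_univ (μ := runMeasure exSampling σ (P.cfg.start ν))]
  refine measure_mono_ae ?_
  filter_upwards [hP.ae_path σ (P.cfg.start ν)] with ω ⟨_, hω⟩ _
  exact (termTime_lt_top_iff ω).2 ⟨_, terminal_of_rank hω rank hrank⟩

/-- If the number of steps of `P` is bounded by the rank of the start configuration, then the
expectation of `R` after `P` is at most the initial value of any supermartingale `g` with bounded
steps that equals `R` at the terminal configurations. -/
theorem expectedDecrease_of_supermartingale {P : Prog Ops p 1} (hP : P.cfg.CoinDriven)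
    (rank : Config P.cfg → ℕ)
    (hrank : ∀ (c : Config P.cfg) (b : Bool), c.loc ≠ none → rank (coinStep c b) < rank c)
    (R : Val p → ℝ) (δ : ℝ) (g : Config P.cfg → ℝ) (K : ℝ)
    (hg : ∀ c b, |g (coinStep c b) - g c| ≤ K)
    (hsup : ∀ c : Config P.cfg, (g (coinStep c true) + g (coinStep c false)) / 2 ≤ g c)
    (hterm : ∀ c : Config P.cfg, c.loc = none → g c = R c.val)
    (hstart : ∀ ν, g (P.cfg.start ν) = R ν - δ) :
    ExpectedDecrease exSampling R P δ := by
  rintro ν z rfl σ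
  have hfinal : (fun ω : Run P.cfg => R (finalVal ω)) =ᵐ[runMeasure exSampling σ (P.cfg.start ν)]
      fun ω => g (ω (rank (P.cfg.start ν))) := by
    filter_upwards [hP.ae_path σ (P.cfg.start ν)] with ω ⟨h0, hω⟩
    have h := terminal_of_rank hω rank hrank
    rw [h0] at h
    rw [finalVal_eq hω h, hterm _ h]
  rw [integrable_congr hfinal, integral_congr_ae hfinal]
  exact ⟨hP.integrable_of_bounded_steps g K hg σ _ _,
    (hP.integral_le_of_supermartingale g K hg hsup σ _ _).trans_eq (hstart ν)⟩

theorem integrableAlong_of_bounded_steps {P : Prog Ops p 1} (hP : P.cfg.CoinDriven)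
    (R : Val p → ℝ) (K : ℝ)
    (hR : ∀ (c : Config P.cfg) b, |R (coinStep c b).val - R c.val| ≤ K) :
    IntegrableAlong exSampling R P := fun _ σ n =>
  hP.integrable_of_bounded_steps (fun c => R c.val) K hR σ _ n

theorem differenceBounded_of_bounded_steps {P : Prog Ops p 1} (hP : P.cfg.CoinDriven)
    (R : Val p → ℝ) (K : ℝ) (hK : 0 < K)
    (hR : ∀ (c : Config P.cfg) b, |R (coinStep c b).val - R c.val| ≤ K) :
    DifferenceBounded exSampling R P := by
  refine ⟨K, hK, fun ν σ n => ?_⟩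
  filter_upwards [hP.ae_path σ (P.cfg.start ν)] with ω ⟨_, hω⟩
  obtain ⟨b, hb⟩ := hω n
  rw [hb]
  exact hR _ b

theorem available_nonempty {q : ℕ} {C : CFG Ops p q} (c : Config C) : (available c).Nonempty := by
  rcases c with ⟨_ | l, ν⟩
  · exact ⟨Act.tau, rfl⟩
  · unfold available
    simp only
    split
    · exact ⟨Act.thenBranch, Or.inl rfl⟩
    · exact ⟨Act.tau, rfl⟩

instance {q : ℕ} (C : CFG Ops p q) : Nonempty (Scheduler C) :=
  ⟨⟨fun _ h => PMF.pure (available_nonempty h.last).some, fun _ h => by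
    simpa using (available_nonempty h.last).some_mem⟩⟩

end Rule

/-! ### The premises of the rule for the nested-loop program -/

section Premises

variable {Ops : Set (ℤ → ℤ → ℤ)}

theorem exInner_coinDriven : (exInner Ops).cfg.CoinDriven := by
  rintro (_ | (_ | _ | _) | _) <;> trivial

theorem exProg_coinDriven : (exProg Ops).cfg.CoinDriven := by
  rintro (_ | _ | (_ | (_ | _ | _) | _) | _ | _) <;> trivial

theorem assign_coinDriven {p : ℕ} (v : Fin p) (e : AExpr Ops (Fin p ⊕ Fin 1)) :
    (Prog.assign v e).cfg.CoinDriven := fun _ => trivial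

theorem abs_add_coinSample_sub_le (x : ℤ) (b : Bool) :
    |((x + coinSample b 0 : ℤ) : ℝ) - x| ≤ 1 := by
  cases b <;> simp [coinSample]

theorem exInner_step_x (c : Config (exInner Ops).cfg) (b : Bool) :
    |((coinStep c b).val exX : ℝ) - c.val exX| ≤ 1 := by
  rcases c with ⟨_ | (_ | (_ | _ | _) | _), ν⟩
  case some.some.inl.some.inl => exact abs_add_coinSample_sub_le (ν exX) b
  all_goals
    change |(ν exX : ℝ) - ν exX| ≤ 1
    simp

theorem exProg_step_x (c : Config (exProg Ops).cfg) (b : Bool) :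
    |((coinStep c b).val exX : ℝ) - c.val exX| ≤ 1 := by
  rcases c with ⟨_ | (_ | _ | (_ | (_ | _ | _) | _) | _ | _), ν⟩
  case some.some.inr.inl.some.inl.some.inl => exact abs_add_coinSample_sub_le (ν exX) b
  case some.some.inr.inr.inr =>
    change |((ν exX - 1 : ℤ) : ℝ) - ν exX| ≤ 1
    simp
  all_goals
    change |(ν exX : ℝ) - ν exX| ≤ 1
    simp

/-- The number of steps that an assignment still takes. -/
def assignRank {p : ℕ} {v : Fin p} {e : AExpr Ops (Fin p ⊕ Fin 1)}
    (c : Config (Prog.assign v e).cfg) : ℕ :=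
  if c.loc = none then 0 else 1

theorem assignRank_lt {p : ℕ} (v : Fin p) (e : AExpr Ops (Fin p ⊕ Fin 1))
    (c : Config (Prog.assign v e).cfg) (b : Bool) (hc : c.loc ≠ none) :
    assignRank (coinStep c b) < assignRank c := by
  rcases c with ⟨_ | l, ν⟩
  · exact absurd rfl hc
  · exact Nat.zero_lt_one

theorem exInner_mean_x (c : Config (exInner Ops).cfg) :
    (((coinStep c true).val exX : ℝ) + (coinStep c false).val exX) / 2 = c.val exX := by
  rcases c with ⟨_ | (_ | (_ | _ | _) | _), ν⟩
  case some.some.inl.some.inl =>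
    change (((ν exX + 1 : ℤ) : ℝ) + (ν exX + -1 : ℤ)) / 2 = ν exX
    push_cast
    ring
  all_goals
    change ((ν exX : ℝ) + ν exX) / 2 = ν exX
    ring

/-- An assignment that subtracts `d` from `x`, whatever the sampled value, lowers the expected
value of `x` by `d`. -/
theorem expectedDecrease_assign {v : Fin 3} {e : AExpr Ops (Fin 3 ⊕ Fin 1)} (d : ℤ)
    (hx : ∀ (ν : Val 3) (μ : Fin 1 → ℤ),
      Function.update ν v (e.eval (Sum.elim ν μ)) exX = ν exX - d) :
    ExpectedDecrease exSampling (fun ν : Val 3 => (ν exX : ℝ)) (.assign v e) d := by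
  -- Before the assignment, the decrease that is still to come is accounted for.
  have hstep : ∀ (c : Config (Prog.assign v e).cfg) b,
      (((coinStep c b).val exX : ℝ) - if (coinStep c b).loc = none then 0 else (d : ℝ)) =
        (c.val exX : ℝ) - if c.loc = none then 0 else (d : ℝ) := by
    rintro ⟨_ | l, ν⟩ b
    · rfl
    · have h := hx ν (coinSample b)
      change ((Function.update ν v (e.eval (Sum.elim ν (coinSample b))) exX : ℤ) : ℝ) - 0 =
        (ν exX : ℝ) - d
      rw [h]
      simp
  refine expectedDecrease_of_supermartingale (assign_coinDriven v e) assignRank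
    (assignRank_lt v e) _ _
    (fun c => (c.val exX : ℝ) - if c.loc = none then 0 else (d : ℝ)) 0 ?_ ?_ ?_ ?_
  · intro c b
    simp only [hstep, sub_self, abs_zero, le_refl]
  · intro c
    simp only [hstep, add_self_div_two, le_refl]
  · intro c hc
    simp [hc]
  · intro ν
    rfl

theorem bounded_assign {v : Fin 3} {e : AExpr Ops (Fin 3 ⊕ Fin 1)} (d : ℤ) (hd : |d| ≤ 1)
    (hx : ∀ (ν : Val 3) (μ : Fin 1 → ℤ),
      Function.update ν v (e.eval (Sum.elim ν μ)) exX = ν exX - d)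
    (c : Config (Prog.assign v e).cfg) (b : Bool) :
    |((coinStep c b).val exX : ℝ) - c.val exX| ≤ 1 := by
  rcases c with ⟨_ | l, ν⟩
  · change |(ν exX : ℝ) - ν exX| ≤ 1
    simp
  · change |((Function.update ν v (e.eval (Sum.elim ν (coinSample b))) exX : ℤ) : ℝ) - ν exX| ≤ 1
    rw [hx, ← Int.cast_sub, sub_sub_cancel_left, Int.cast_neg, abs_neg]
    exact_mod_cast hd

/-- An upper bound on the number of steps that the inner loop still takes. -/
def exInnerRank (c : Config (exInner Ops).cfg) : ℕ :=
  match (show Option (Option (Option (Unit ⊕ Unit) ⊕ Unit)) from c.loc) with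
  | none => 0
  | some none => 4 * (c.val exZ + 1).toNat + 1
  | some (some (.inl none)) => 4 * (c.val exZ).toNat + 4
  | some (some (.inl (some _))) => 4 * (c.val exZ).toNat + 3
  | some (some (.inr _)) => 4 * (c.val exZ).toNat + 2

theorem exInnerRank_lt (c : Config (exInner Ops).cfg) (b : Bool) (hc : c.loc ≠ none) :
    exInnerRank (coinStep c b) < exInnerRank c := by
  rcases c with ⟨_ | (_ | (_ | _ | _) | _), ν⟩
  · exact absurd rfl hc
  -- At the branchings, `g` is the truth value of the guard.
  · suffices h : ∀ g : Bool, (g = true → ν exZ ≥ 0) →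
        exInnerRank (Ops := Ops) ⟨if g then some (some (.inl none)) else none, ν⟩ <
          4 * (ν exZ + 1).toNat + 1 from h _ of_decide_eq_true
    rintro (_ | _) h
    · change 0 < 4 * (ν exZ + 1).toNat + 1
      omega
    · have := h rfl
      change 4 * (ν exZ).toNat + 4 < 4 * (ν exZ + 1).toNat + 1
      omega
  · suffices h : ∀ g : Bool, exInnerRank (Ops := Ops)
        ⟨if g then some (some (.inl (some (.inl ()))))
          else some (some (.inl (some (.inr ())))), ν⟩ <
          4 * (ν exZ).toNat + 4 from h _
    rintro (_ | _) <;> exact Nat.lt_succ_self _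
  · change 4 * (ν exZ).toNat + 2 < 4 * (ν exZ).toNat + 3
    omega
  · change 4 * (ν exZ).toNat + 2 < 4 * (ν exZ).toNat + 3
    omega
  · change 4 * (ν exZ - 1 + 1).toNat + 1 < 4 * (ν exZ).toNat + 2
    omega

theorem assign_terminates {p : ℕ} (v : Fin p) (e : AExpr Ops (Fin p ⊕ Fin 1)) :
    (Prog.assign v e).Terminates exSampling :=
  Prog.terminates_of_rank (assign_coinDriven v e) assignRank (assignRank_lt v e)

theorem expectedDecrease_exInner :
    ExpectedDecrease exSampling (fun ν : Val 3 => (ν exX : ℝ)) (exInner Ops) 0 :=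
  expectedDecrease_of_supermartingale exInner_coinDriven exInnerRank exInnerRank_lt _ _
    (fun c => (c.val exX : ℝ)) 1 exInner_step_x (fun c => (exInner_mean_x c).le) (fun _ _ => rfl)
    fun ν => (sub_zero (ν exX : ℝ)).symm

theorem isPropLinear_x : IsPropLinear fun ν : Val 3 => (ν exX : ℝ) := by
  refine ⟨[(.nonpos ⟨0, 0⟩, ⟨Pi.single exX 1, 0⟩)], fun ν => ?_⟩
  simp [LinPred.Holds, Affine.eval, Pi.single_apply]

theorem exProg_boundedRulePremises (Ops : Set (ℤ → ℤ → ℤ)) :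
    BoundedRulePremises exSampling (exGuard Ops) (exBody Ops) (fun ν => (ν exX : ℝ)) := by
  have hZ : ∀ (ν : Val 3) (μ : Fin 1 → ℤ), Function.update ν exZ
      ((AExpr.var (.inl exY) : AExpr Ops _).eval (Sum.elim ν μ)) exX = ν exX - 0 :=
    fun ν _ => (sub_zero (ν exX)).symm
  have hY : ∀ (ν : Val 3) (μ : Fin 1 → ℤ), Function.update ν exY
      ((AExpr.mul (.const 4) (.var (.inl exY)) : AExpr Ops _).eval (Sum.elim ν μ)) exX =
        ν exX - 0 :=
    fun ν _ => (sub_zero (ν exX)).symm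
  have hX : ∀ (ν : Val 3) (μ : Fin 1 → ℤ), Function.update ν exX
      ((AExpr.sub (.var (.inl exX)) (.const 1) : AExpr Ops _).eval (Sum.elim ν μ)) exX =
        ν exX - 1 :=
    fun ν _ => rfl
  have hZ' := expectedDecrease_assign 0 hZ
  have hY' := expectedDecrease_assign 0 hY
  have hX' := expectedDecrease_assign 1 hX
  simp only [Int.cast_zero, Int.cast_one] at hZ' hY' hX'
  have hall : ∀ Q : Prog Ops 3 1 → Prop, Q (.assign exZ (.var (.inl exY))) → Q (exInner Ops) →
      Q (.assign exY (.mul (.const 4) (.var (.inl exY)))) →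
      Q (.assign exX (.sub (.var (.inl exX)) (.const 1))) → ∀ P ∈ exBody Ops, Q P := by
    intro Q h1 h2 h3 h4 P hP
    simp only [exBody, List.mem_cons, List.not_mem_nil, or_false] at hP
    rcases hP with rfl | rfl | rfl | rfl <;> assumption
  have hbdd : ∀ P ∈ exBody Ops, P.cfg.CoinDriven ∧ ∀ (c : Config P.cfg) b,
      |((coinStep c b).val exX : ℝ) - c.val exX| ≤ 1 :=
    hall _ ⟨assign_coinDriven _ _, bounded_assign 0 (by simp) hZ⟩
      ⟨exInner_coinDriven, exInner_step_x⟩ ⟨assign_coinDriven _ _, bounded_assign 0 (by simp) hY⟩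
      ⟨assign_coinDriven _ _, bounded_assign 1 (by simp) hX⟩
  refine ⟨⟨?_, 1, isPropLinear_x, one_pos, ?_, ?_, ?_⟩, ?_, ?_, ?_, ?_⟩
  · exact hall _ (assign_terminates _ _)
      (Prog.terminates_of_rank exInner_coinDriven exInnerRank exInnerRank_lt)
      (assign_terminates _ _) (assign_terminates _ _)
  · intro ν h
    have h' : ν exX ≥ 1 := of_decide_eq_true h
    exact_mod_cast (zero_le_one.trans h' : (0 : ℤ) ≤ ν exX)
  · refine hall _ hZ' expectedDecrease_exInner hY' fun ν z hz σ => ?_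
    obtain ⟨hi, hle⟩ := hX' ν z hz σ
    exact ⟨hi, hle.trans (by linarith)⟩
  · exact ⟨_, by simp [exBody], hX'⟩
  · exact integrableAlong_of_bounded_steps exProg_coinDriven _ 1 exProg_step_x
  · exact fun P hP => integrableAlong_of_bounded_steps (hbdd P hP).1 _ 1 (hbdd P hP).2
  · exact differenceBounded_of_bounded_steps exProg_coinDriven _ 1 one_pos exProg_step_x
  · exact fun P hP => differenceBounded_of_bounded_steps (hbdd P hP).1 _ 1 one_pos (hbdd P hP).2

end Premises

/-! ### A supermartingale for the random walk of the inner loop -/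

/-- The base `1 - 1 / √y` of the exponential martingale of the random walk. -/
noncomputable def walkBase (y : ℤ) : ℝ := 1 - 1 / √y

/-- The discount factor for which `(walkDiscount y) ^ k * (walkBase y) ^ d`, with `k` the number of
steps done and `d` the distance from the target, is a martingale of the random walk. -/
noncomputable def walkDiscount (y : ℤ) : ℝ := 2 * walkBase y / (1 + walkBase y ^ 2)

theorem one_le_sqrt {y : ℤ} (hy : 1 ≤ y) : 1 ≤ √(y : ℝ) :=
  Real.one_le_sqrt.2 (by exact_mod_cast hy)

theorem walkBase_nonneg {y : ℤ} (hy : 1 ≤ y) : 0 ≤ walkBase y :=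
  sub_nonneg.2 (div_le_one_of_le₀ (one_le_sqrt hy) (Real.sqrt_nonneg _))

theorem walkBase_le_one (y : ℤ) : walkBase y ≤ 1 :=
  sub_le_self _ (by positivity)

theorem walkDiscount_nonneg {y : ℤ} (hy : 1 ≤ y) : 0 ≤ walkDiscount y := by
  have := walkBase_nonneg hy
  unfold walkDiscount
  positivity

theorem walkDiscount_mul (y : ℤ) : walkDiscount y * (1 + walkBase y ^ 2) = 2 * walkBase y :=
  div_mul_cancel₀ _ (by positivity)

theorem walkDiscount_le_one (y : ℤ) : walkDiscount y ≤ 1 := by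
  rw [walkDiscount, div_le_one (by positivity)]
  nlinarith [sq_nonneg (1 - walkBase y)]

/-- The discount over at least `y` steps is bounded away from `1`. -/
theorem walkDiscount_pow_le {y : ℤ} (hy : 1 ≤ y) {k : ℕ} (hk : y ≤ k) :
    walkDiscount y ^ k ≤ 2 / 3 := by
  have hy0 : (0 : ℝ) < y := by exact_mod_cast (by omega : 0 < y)
  have hδ : (1 - walkBase y) ^ 2 = 1 / y := by
    rw [walkBase, sub_sub_cancel, div_pow, Real.sq_sqrt hy0.le, one_pow]
  have hk' : (y : ℝ) ≤ k := by exact_mod_cast hk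
  have h1 : walkDiscount y ≤ (1 + 1 / (2 * (y : ℝ)))⁻¹ := by
    rw [walkDiscount, ← one_div, div_le_div_iff₀ (by positivity) (by positivity)]
    have : 1 / (2 * (y : ℝ)) = (1 - walkBase y) ^ 2 / 2 := by rw [hδ]; field_simp
    rw [this]
    nlinarith [sq_nonneg (1 - walkBase y), walkBase_le_one y,
      mul_nonneg (sub_nonneg.2 (walkBase_le_one y)) (sq_nonneg (1 - walkBase y))]
  have h2 : 3 / 2 ≤ (1 + 1 / (2 * (y : ℝ))) ^ k := by
    refine le_trans ?_ (one_add_mul_le_pow (a := 1 / (2 * (y : ℝ)))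
      (by have : 0 < 1 / (2 * (y : ℝ)) := by positivity
          linarith) k)
    have : 1 / 2 ≤ k * (1 / (2 * (y : ℝ))) := by
      rw [mul_one_div, div_le_div_iff₀ two_pos (by positivity)]
      linarith
    linarith
  calc walkDiscount y ^ k ≤ ((1 + 1 / (2 * (y : ℝ)))⁻¹) ^ k :=
        pow_le_pow_left₀ (walkDiscount_nonneg hy) h1 k
    _ = ((1 + 1 / (2 * (y : ℝ))) ^ k)⁻¹ := inv_pow _ _
    _ ≤ (3 / 2)⁻¹ := inv_anti₀ (by norm_num) h2
    _ = 2 / 3 := by norm_num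

/-- The potential at the head of the outer loop, a bound on the probability of termination. The
value `6 / √y` solves `f y = 3 / √y + f (4 * y)`. It is informative only where `x = 1` and `1 ≤ y`;
elsewhere the trivial bound `1` is taken. -/
noncomputable def outerPotential (x y : ℤ) : ℝ :=
  if x = 1 ∧ 1 ≤ y then min 1 (6 / √y) else 1

/-- The potential at the head of the inner loop. The first summand bounds the probability that the
random walk does not reach `2` before the inner loop ends (the factor `3` is chosen because
`1 - λ ^ k * ρ ^ d ≥ 1 / 3` in that event, see `walkDiscount_pow_le`); the second one is the
potential with which the outer loop continues otherwise. -/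
noncomputable def innerPotential (x y z : ℤ) : ℝ :=
  if 1 ≤ y ∧ z ≤ y ∧ x ≤ 2 then
    min 1 ((if x = 2 then 0 else
      3 * (1 - walkDiscount y ^ (y - z).toNat * walkBase y ^ (2 - x).toNat)) + 3 / √y)
  else 1

theorem outerPotential_le_one (x y : ℤ) : outerPotential x y ≤ 1 := by
  unfold outerPotential
  split_ifs
  exacts [min_le_left _ _, le_rfl]

theorem outerPotential_nonneg (x y : ℤ) : 0 ≤ outerPotential x y := by
  unfold outerPotential
  split_ifs <;> positivity

theorem innerPotential_le_one (x y z : ℤ) : innerPotential x y z ≤ 1 := by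
  unfold innerPotential
  split_ifs
  exacts [min_le_left _ _, min_le_left _ _, le_rfl]

theorem one_sub_walk_nonneg {y : ℤ} (hy : 1 ≤ y) (k d : ℕ) :
    0 ≤ 1 - walkDiscount y ^ k * walkBase y ^ d :=
  sub_nonneg.2 (mul_le_one₀ (pow_le_one₀ (walkDiscount_nonneg hy) (walkDiscount_le_one y))
    (pow_nonneg (walkBase_nonneg hy) d) (pow_le_one₀ (walkBase_nonneg hy) (walkBase_le_one y)))

theorem innerPotential_nonneg (x y z : ℤ) : 0 ≤ innerPotential x y z := by
  unfold innerPotential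
  split_ifs with h
  · positivity
  · have := one_sub_walk_nonneg h.1 (y - z).toNat (2 - x).toNat
    positivity
  · exact zero_le_one

theorem innerPotential_start_le (x y : ℤ) : innerPotential x y y ≤ outerPotential x y := by
  unfold outerPotential
  split_ifs with h
  · obtain ⟨rfl, hy⟩ := h
    rw [innerPotential, if_pos ⟨hy, le_rfl, by norm_num⟩]
    refine le_of_eq ?_
    congr 1
    simp [walkBase]
    ring
  · exact innerPotential_le_one _ _ _

theorem innerPotential_skip_le {x : ℤ} (hx : 2 ≤ x) (y z : ℤ) :
    innerPotential x y (z - 1) ≤ innerPotential x y z := by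
  by_cases h : 1 ≤ y ∧ z ≤ y ∧ x ≤ 2
  · have hx2 : x = 2 := le_antisymm h.2.2 hx
    rw [innerPotential, innerPotential, if_pos h, if_pos ⟨h.1, by omega, h.2.2⟩, if_pos hx2,
      if_pos hx2]
  · rw [innerPotential.eq_def x y z, if_neg h]
    exact innerPotential_le_one _ _ _

/-- The step `x := x + r; z := z - 1` of the walk. If `x + 1` is the target `2`, the potential is
dominated by the martingale because the latter is nonnegative there. -/
theorem innerPotential_walk_le {x : ℤ} (hx : x < 2) (y z : ℤ) :
    (innerPotential (x + 1) y (z - 1) + innerPotential (x - 1) y (z - 1)) / 2 ≤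
      innerPotential x y z := by
  have h1 := innerPotential_le_one (x + 1) y (z - 1)
  have h2 := innerPotential_le_one (x - 1) y (z - 1)
  by_cases h : 1 ≤ y ∧ z ≤ y ∧ x ≤ 2
  swap
  · rw [innerPotential.eq_def x y z, if_neg h]
    linarith
  rw [innerPotential.eq_def x y z, if_pos h, if_neg hx.ne]
  refine le_min (by linarith) ?_
  have hle : ∀ x' : ℤ, x' ≤ 2 → innerPotential x' y (z - 1) ≤
      3 * (1 - walkDiscount y ^ (y - (z - 1)).toNat * walkBase y ^ (2 - x').toNat) + 3 / √y := by
    intro x' hx'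
    rw [innerPotential, if_pos ⟨h.1, by omega, hx'⟩]
    refine (min_le_right _ _).trans (add_le_add ?_ le_rfl)
    have := one_sub_walk_nonneg h.1 (y - (z - 1)).toNat (2 - x').toNat
    split_ifs
    · positivity
    · exact le_rfl
  have h3 := hle (x + 1) (by omega)
  have h4 := hle (x - 1) (by omega)
  obtain ⟨d, hd⟩ : ∃ d : ℕ, 2 - x = d + 1 := ⟨(1 - x).toNat, by omega⟩
  rw [show (2 - (x + 1)).toNat = d by omega,
    show (y - (z - 1)).toNat = (y - z).toNat + 1 by omega] at h3
  rw [show (2 - (x - 1)).toNat = d + 2 by omega,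
    show (y - (z - 1)).toNat = (y - z).toNat + 1 by omega] at h4
  rw [show (2 - x).toNat = d + 1 by omega]
  have hmart : walkDiscount y ^ ((y - z).toNat + 1) * walkBase y ^ d +
      walkDiscount y ^ ((y - z).toNat + 1) * walkBase y ^ (d + 2) =
        2 * (walkDiscount y ^ (y - z).toNat * walkBase y ^ (d + 1)) := by
    linear_combination walkDiscount y ^ (y - z).toNat * walkBase y ^ d * walkDiscount_mul y
  linarith

/-- The exit of the inner loop. At the target `2`, the outer loop starts again with `x = 1` and the
fourfold `y`; elsewhere the potential has already reached `1`. -/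
theorem outerPotential_restart_le {z : ℤ} (hz : z < 0) (x y : ℤ) :
    outerPotential (x - 1) (4 * y) ≤ innerPotential x y z := by
  by_cases h : 1 ≤ y ∧ z ≤ y ∧ x ≤ 2
  swap
  · rw [innerPotential, if_neg h]
    exact outerPotential_le_one _ _
  rw [innerPotential, if_pos h]
  refine le_min (outerPotential_le_one _ _) ?_
  split_ifs with hx
  · rw [outerPotential, if_pos ⟨by omega, by omega⟩]
    refine (min_le_right _ _).trans (le_of_eq ?_)
    have : √((4 * y : ℤ) : ℝ) = 2 * √(y : ℝ) := by
      push_cast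
      rw [Real.sqrt_mul (by norm_num), show (4 : ℝ) = 2 ^ 2 by norm_num,
        Real.sqrt_sq (by norm_num)]
    rw [this, zero_add, show (6 : ℝ) = 2 * 3 by norm_num, mul_div_mul_left _ _ two_ne_zero]
  · refine (outerPotential_le_one _ _).trans ?_
    have h1 : walkDiscount y ^ (y - z).toNat * walkBase y ^ (2 - x).toNat ≤ 2 / 3 :=
      (mul_le_of_le_one_right (pow_nonneg (walkDiscount_nonneg h.1) _)
        (pow_le_one₀ (walkBase_nonneg h.1) (walkBase_le_one y))).trans
        (walkDiscount_pow_le h.1 (by omega))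
    have h2 : 0 ≤ 3 / √(y : ℝ) := by positivity
    linarith

/-! ### Divergence of the nested-loop program -/

section Divergence

variable {Ops : Set (ℤ → ℤ → ℤ)}

/-- The potential of a configuration of the program: a bound on the probability of termination. At
the labels that lie between the two loop heads it is the potential of the loop head that is reached
next; before `x := x + r` it is averaged over the value of `r`. -/
noncomputable def exPotential (c : Config (exProg Ops).cfg) : ℝ :=
  match (show Option (Option (Unit ⊕ (Option (Option (Unit ⊕ Unit) ⊕ Unit) ⊕ (Unit ⊕ Unit))))
    from c.loc) with
  | none => 1
  | some none => outerPotential (c.val exX) (c.val exY)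
  | some (some (.inl _)) => innerPotential (c.val exX) (c.val exY) (c.val exY)
  | some (some (.inr (.inl none))) => innerPotential (c.val exX) (c.val exY) (c.val exZ)
  | some (some (.inr (.inl (some (.inl none))))) =>
    innerPotential (c.val exX) (c.val exY) (c.val exZ)
  | some (some (.inr (.inl (some (.inl (some (.inl _))))))) =>
    (innerPotential (c.val exX + 1) (c.val exY) (c.val exZ - 1) +
      innerPotential (c.val exX - 1) (c.val exY) (c.val exZ - 1)) / 2
  | some (some (.inr (.inl (some (.inl (some (.inr _))))))) =>
    innerPotential (c.val exX) (c.val exY) (c.val exZ - 1)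
  | some (some (.inr (.inl (some (.inr _))))) =>
    innerPotential (c.val exX) (c.val exY) (c.val exZ - 1)
  | some (some (.inr (.inr (.inl _)))) => outerPotential (c.val exX - 1) (4 * c.val exY)
  | some (some (.inr (.inr (.inr _)))) => outerPotential (c.val exX - 1) (c.val exY)

theorem exPotential_nonneg (c : Config (exProg Ops).cfg) : 0 ≤ exPotential c := by
  have h1 := outerPotential_nonneg
  have h2 := innerPotential_nonneg
  unfold exPotential
  split
  case h_6 => exact div_nonneg (add_nonneg (h2 _ _ _) (h2 _ _ _)) zero_le_two
  all_goals first | exact zero_le_one | exact h1 _ _ | exact h2 _ _ _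

/-- The potential does not increase in expectation. -/
theorem exPotential_step (c : Config (exProg Ops).cfg) :
    (exPotential (coinStep c true) + exPotential (coinStep c false)) / 2 ≤ exPotential c := by
  -- At all labels but that of `x := x + r`, the two summands are equal.
  have hdet : ∀ a b : ℝ, a ≤ b → (a + a) / 2 ≤ b := fun a b h => by linarith
  rcases c with ⟨_ | (_ | _ | (_ | (_ | _ | _) | _) | _ | _), ν⟩
  case some.none =>
    refine hdet _ _ ?_
    -- Here and at the other branchings, `g` is the truth value of the guard.
    suffices h : ∀ g : Bool, (g = false → ¬ ν exX ≥ 1) →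
        exPotential (Ops := Ops) ⟨if g then some (some (.inl ())) else none, ν⟩ ≤
          outerPotential (ν exX) (ν exY) from h _ of_decide_eq_false
    rintro (_ | _) h
    · have hx : ¬ (ν exX = 1 ∧ 1 ≤ ν exY) := fun hx => h rfl hx.1.ge
      rw [outerPotential, if_neg hx]
      exact le_refl (1 : ℝ)
    · exact innerPotential_start_le _ _
  case some.some.inr.inl.none =>
    refine hdet _ _ ?_
    suffices h : ∀ g : Bool, (g = false → ¬ ν exZ ≥ 0) → exPotential (Ops := Ops)
        ⟨if g then some (some (.inr (.inl (some (.inl none)))))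
          else some (some (.inr (.inr (.inl ())))), ν⟩ ≤
        innerPotential (ν exX) (ν exY) (ν exZ) from h _ of_decide_eq_false
    rintro (_ | _) h
    · exact outerPotential_restart_le (not_le.1 (h rfl)) _ _
    · exact le_rfl
  case some.some.inr.inl.some.inl.none =>
    refine hdet _ _ ?_
    suffices h : ∀ g : Bool, (g = decide (ν exX < 2)) → exPotential (Ops := Ops)
        ⟨if g then some (some (.inr (.inl (some (.inl (some (.inl ())))))))
          else some (some (.inr (.inl (some (.inl (some (.inr ()))))))), ν⟩ ≤
        innerPotential (ν exX) (ν exY) (ν exZ) from h _ rfl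
    rintro (_ | _) h
    · exact innerPotential_skip_le (not_lt.1 (of_decide_eq_false h.symm)) _ _
    · exact innerPotential_walk_le (of_decide_eq_true h.symm) _ _
  case some.some.inr.inl.some.inl.some.inl => exact le_rfl
  all_goals exact hdet _ _ le_rfl

theorem exProg_not_terminatesFrom {ν : Val 3} (hx : ν exX = 1) (hy : 37 ≤ ν exY) :
    ¬ (exProg Ops).TerminatesFrom exSampling ν := by
  intro h
  obtain ⟨σ⟩ : Nonempty (Scheduler (exProg Ops).cfg) := inferInstance
  have hle := exProg_coinDriven.measure_termination_le exPotential exPotential_nonneg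
    (by
      rintro ⟨_ | l, ν⟩ hc
      · exact le_rfl
      · cases hc)
    exPotential_step σ ((exProg Ops).cfg.start ν)
  rw [h σ, ENNReal.one_le_ofReal] at hle
  change 1 ≤ outerPotential (ν exX) (ν exY) at hle
  rw [outerPotential, if_pos ⟨hx, by omega⟩] at hle
  have hle' := hle.trans (min_le_right _ _)
  have hy' : (37 : ℝ) ≤ ν exY := by exact_mod_cast hy
  have hs : 6 < √(ν exY : ℝ) := Real.lt_sqrt_of_sq_lt (by linarith)
  rw [one_le_div (by linarith)] at hle'
  linarith

end Divergence

end FHV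

theorem mainTheorem2 (Ops : Set (ℤ → ℤ → ℤ)) :
    ¬ FHV.RuleSound Ops ∧
    ¬ FHV.BoundedRuleSound Ops ∧
    FHV.BoundedRulePremises FHV.exSampling (FHV.exGuard Ops) (FHV.exBody Ops)
      (fun ν => (ν FHV.exX : ℝ)) ∧
    ∃ Y : ℤ, ∀ ν : FHV.Val 3, ν FHV.exX = 1 → Y ≤ ν FHV.exY →
      ¬ (FHV.exProg Ops).TerminatesFrom FHV.exSampling ν := by
  have hprem := FHV.exProg_boundedRulePremises Ops
  have hdiv : ¬ (FHV.exProg Ops).Terminates FHV.exSampling := fun h =>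
    FHV.exProg_not_terminatesFrom (ν := fun i => if i = FHV.exX then 1 else 37) rfl le_rfl (h _)
  exact ⟨fun h => hdiv (h 3 1 _ _ _ _ hprem.toRulePremises), fun h => hdiv (h 3 1 _ _ _ _ hprem),
    hprem, 37, fun ν hx hy => FHV.exProg_not_terminatesFrom hx hy⟩
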